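/- Let $K$ be a number field with a fixed algebraic closure $\overline K$, let $p$ be a prime number, let $S$ be a finite set of nonzero prime ideals of $\mathcal O_K$, and let $\nu : S\to[0,\infty)$, $\mathfrak p\mapsto\nu_{\mathfrak p}$ (that is, $(S,\nu)$ is a finitely indexed set for $K$). For a finite Galois extension $F/K$ and a prime $\mathfrak P$ of $F$ over the prime $\mathfrak p$ of $K$, let $D_x(F/K,\mathfrak P)$ and $D^y(F/K,\mathfrak P)$ denote the ramification groups in the lower and upper numbering: for real $x\ge -1$, $D_x(F/K,\mathfrak P)$ consists of the $\sigma$ in the stabilizer of $\mathfrak P$ in $\mathrm{Gal}(F/K)$ with $v_{\mathfrak P}(\sigma(\alpha)-\alpha)\ge x+1$ for all $\alpha\in\mathcal O_F$; and $D^y=D_{\psi(y)}$ for real $y\ge-1$, where $\psi$ is the inverse of the bijection $\varphi:[-1,\infty)\to[-1,\infty)$ given by $\varphi(u)=u$ for $-1\le u\le0$ and $\varphi(u)=\frac1{g_0}\bigl(g_1+\dots+g_m+(u-m)g_{m+1}\bigr)$ for $u\ge0$, $m=\lfloor u\rfloor$, $g_i=|D_i(F/K,\mathfrak P)|$. Let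 $K_{S,\nu}$ be the compositum in $\overline K$ of all finite Galois extensions $F\subset\overline K$ of $K$ of $p$-power degree which are unramified at all finite primes outside $S$ and at all infinite places, and for which $D^{\nu_{\mathfrak p}}(F/K,\mathfrak P)$ is trivial for every $\mathfrak p\in S$ and every prime $\mathfrak P$ of $F$ over $\mathfrak p$. For a number field $F$ let $\mathrm{rd}_F=|\mathrm{disc}_F|^{1/[F:\mathbb Q]}$ be its root discriminant, write $N\mathfrak p=|\mathcal O_K/\mathfrak p|$, and let $S_p$ be the set of primes of $K$ of residue characteristic $p$. **Theorem 4.2.** The root discriminants of the finite extensions $L$ of $K$ contained in $K_{S,\nu}$ are bounded. More precisely, every finite extension $L$ of $K$ contained in $K_{S,\nu}$ satisfies $$\mathrm{rd}_L\le \mathrm{rd}_K\cdot\prod_{\mathfrak p\in S- S_p}(N\mathfrak p)^{1/[K:\mathbb Q]}\cdot\prod_{\mathfrak p\in S\cap S_p}(N\mathfrak p)^{(\nu_{\mathfrak p}+1)/[K:\mathbb Q]}.$$ In particular, if $K_{S,\nu}/K$ is infinite, then it is asymptotically good: it contains finite extensions of $K$ of arbitrarily large degree, and the root discriminants of all finite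 extensions of $K$ contained in it are bounded. -/

import Mathlib

open NumberField IsDedekindDomain
open scoped ENNReal

noncomputable section

section Ramification

variable (K : Type*) {L : Type*} [Field K] [Field L] [Algebra K L]

/-- The ramification group `D_x(L/K, 𝔓)` in the lower numbering, `x ≥ -1`: the elements `σ` of the
decomposition group of `𝔓` (its stabilizer in `Gal(L/K)`) with `v_𝔓 (σ α - α) ≥ x + 1` for all
`α` in the ring of integers of `L`, i.e. with `σ α - α ∈ 𝔓 ^ ⌈x + 1⌉`. -/
def lowerRamificationGroup (𝔓 : Ideal (𝓞 L)) (x : ℝ) : Subgroup Gal(L/K) where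
  carrier := {σ | (∀ α : 𝓞 L, σ • α ∈ 𝔓 ↔ α ∈ 𝔓) ∧
    ∀ α : 𝓞 L, σ • α - α ∈ 𝔓 ^ ⌈x + 1⌉₊}
  one_mem' := by simp
  mul_mem' {a b} ha hb := ⟨fun α ↦ by rw [mul_smul, ha.1, hb.1],
    fun α ↦ by simpa [mul_smul] using add_mem (ha.2 (b • α)) (hb.2 α)⟩
  inv_mem' {a} ha := ⟨fun α ↦ by rw [← ha.1, smul_inv_smul],
    fun α ↦ by simpa using sub_mem_comm_iff.mp (ha.2 (a⁻¹ • α))⟩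

/-- The order `g_i` of the ramification group `D_i(L/K, 𝔓)`. -/
def ramificationOrder (𝔓 : Ideal (𝓞 L)) (i : ℕ) : ℕ :=
  Nat.card (lowerRamificationGroup K 𝔓 (i : ℝ))

/-- The function `φ` from `[-1, ∞)` to `[-1, ∞)`: it is the identity on `[-1, 0]`, and
`φ(u) = (g_1 + ⋯ + g_m + (u - m) g_{m+1}) / g_0` with `m = ⌊u⌋` for `u ≥ 0`. -/
def herbrandPhi (𝔓 : Ideal (𝓞 L)) (u : ℝ) : ℝ :=
  if u ≤ 0 then u else
    (∑ i ∈ Finset.Icc 1 ⌊u⌋₊, (ramificationOrder K 𝔓 i : ℝ) +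
      (u - ⌊u⌋₊) * (ramificationOrder K 𝔓 (⌊u⌋₊ + 1) : ℝ)) / (ramificationOrder K 𝔓 0 : ℝ)

/-- The function `ψ` from `[-1, ∞)` to `[-1, ∞)`, the inverse of `φ`. -/
def herbrandPsi (𝔓 : Ideal (𝓞 L)) (y : ℝ) : ℝ :=
  Function.invFunOn (herbrandPhi K 𝔓) (Set.Ici (-1)) y

/-- The ramification group `D^y(L/K, 𝔓) = D_{ψ(y)}(L/K, 𝔓)` in the upper numbering, `y ≥ -1`. -/
def upperRamificationGroup (𝔓 : Ideal (𝓞 L)) (y : ℝ) : Subgroup Gal(L/K) :=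
  lowerRamificationGroup K 𝔓 (herbrandPsi K 𝔓 y)

end Ramification

section Tower

variable (K : Type*) [Field K]

/-- The ramification of `L/K` at `𝔭` is of depth at most `y ∈ [0, ∞]`: the group `D^y(L/K, 𝔓)` is
trivial for all primes `𝔓` of `L` over `𝔭`. There is no condition if `y = ∞`. -/
def DepthAtMost (L : Type*) [Field L] [Algebra K L] (𝔭 : HeightOneSpectrum (𝓞 K))
    (y : ℝ≥0∞) : Prop :=
  y ≠ ∞ → ∀ 𝔓 : Ideal (𝓞 L), 𝔓.IsPrime → 𝔓.LiesOver 𝔭.asIdeal →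
    upperRamificationGroup K 𝔓 y.toReal = ⊥

/-- The extension `L/K` is unramified at the finite prime `𝔭` of `K`. -/
def UnramifiedAtPrime (L : Type*) [Field L] [Algebra K L] (𝔭 : HeightOneSpectrum (𝓞 K)) : Prop :=
  ∀ (𝔓 : Ideal (𝓞 L)) [𝔓.IsPrime], 𝔓.LiesOver 𝔭.asIdeal → Algebra.IsUnramifiedAt (𝓞 K) 𝔓

/-- `L/K` is a finite `p`-extension (a finite Galois extension whose group is a `p`-group),
unramified at all finite primes outside `S` and at all infinite places, whose ramification at
every `𝔭 ∈ S` is of depth at most `ν 𝔭`. -/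
structure IsBoundedDepthPExtension (p : ℕ) (S : Finset (HeightOneSpectrum (𝓞 K)))
    (ν : S → ℝ≥0∞) (L : Type*) [Field L] [Algebra K L] : Prop where
  finiteDimensional : FiniteDimensional K L
  isGalois : IsGalois K L
  isPGroup : IsPGroup p Gal(L/K)
  unramified_outside : ∀ 𝔭 : HeightOneSpectrum (𝓞 K), 𝔭 ∉ S → UnramifiedAtPrime K L 𝔭
  unramified_infinite : IsUnramifiedAtInfinitePlaces K L
  depth_le : ∀ 𝔭 : S, DepthAtMost K L 𝔭.1 (ν 𝔭)

/-- The field `K_{S,ν}`: the compositum, inside a fixed algebraic closure of `K`, of all finite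
`p`-extensions of `K` which are unramified outside `S` and whose ramification at every `𝔭 ∈ S` is
of depth at most `ν 𝔭`. -/
def boundedDepthTower (Kbar : Type*) [Field Kbar] [Algebra K Kbar] (p : ℕ)
    (S : Finset (HeightOneSpectrum (𝓞 K))) (ν : S → ℝ≥0∞) : IntermediateField K Kbar :=
  sSup {L : IntermediateField K Kbar | IsBoundedDepthPExtension K p S ν L}

/-- The set `S_p` of finite primes of `K` of residue characteristic `p`. -/
def primesOfResidueChar (p : ℕ) : Set (HeightOneSpectrum (𝓞 K)) :=
  {𝔭 | (p : 𝓞 K) ∈ 𝔭.asIdeal}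

end Tower

/-- A finite extension of a number field is a number field. -/
instance numberFieldOfFinite {K Kbar : Type*} [Field K] [NumberField K] [Field Kbar]
    [Algebra K Kbar] (L : IntermediateField K Kbar) [FiniteDimensional K L] : NumberField L :=
  NumberField.of_module_finite K L

/-- The extension `M/K` is asymptotically good: it contains number fields of arbitrarily large
degree over `K`, and the root discriminants of all finite extensions of `K` contained in `M` are
bounded. -/
def IsAsymptoticallyGood {K Kbar : Type*} [Field K] [NumberField K] [Field Kbar]
    [Algebra K Kbar] (M : IntermediateField K Kbar) : Prop :=
  (∀ d : ℕ, ∃ L : IntermediateField K Kbar, L ≤ M ∧ FiniteDimensional K L ∧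
    d ≤ Module.finrank K L) ∧
  ∃ C : ℝ, ∀ (L : IntermediateField K Kbar) [FiniteDimensional K L], L ≤ M → rootDiscr L ≤ C

end

/-!
The root discriminant of `F/K` is that of `K` times a power of the norm of the different, and it
does not decrease in extensions. A finite extension `L` of `K` inside the tower lies in the
compositum `F` of finitely many of the `p`-extensions which define the tower, so it suffices to show
that the exponent of the different of `F/K` at a prime `P` over `𝔭` is at most `e c`, where `e` is
the ramification index and `c` is `0` for `𝔭 ∉ S`, `1` for tame `𝔭 ∈ S` and `ν + 1` for wild
`𝔭 ∈ S`; the identity `∑ e f = [F : K]` then gives the bound for the norm.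

Put `i_P(σ) = min_α v_P(σ α - α)`. The common form of the three local conditions is that
`∑ τ, min (i_P(τ), i_P(σ)) ≤ e c` for all `σ ≠ 1` (`RamificationBound`): in terms of the Herbrand
function the left hand side is `e (φ(i_P(σ) - 1) + 1)`. In the wild case this is what the triviality
of the upper ramification group says, and in the tame case it holds because a nontrivial element of
a `p`-group has `i_P(σ) ≤ 1` at a prime not over `p` (`lowerIndex_le_one_of_isPGroup`).

The condition passes to composita (`ramificationBound_of_tower`), since every `σ ≠ 1` is nontrivial
on one of the fields `E` generating `F`, and its position in the upper numbering does not increase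
from `E` to `F`. This is the part of Herbrand's theorem which is needed, and it rests on the
inequality `∑ t ∈ H, i_P(σ t) ≤ v_P(σ y - y)` for `y` fixed by the subgroup `H`
(`sum_lowerIndex_le_primeOrder_smul_sub`). Tate's argument for it uses that the ring is generated by
a uniformizer over the fixed ring of the inertia group; instead of completing, all statements are
made modulo high powers of `P`.

By evaluating the derivative of the characteristic polynomial at an element `x` with
`v_P(σ x - x) = i_P(σ)` for all `σ`, the exponent of the different at `P` is at most
`∑ σ ≠ 1, i_P(σ)` (`natCast_le_sum_lowerIndex`), which is at most the truncated sum above for a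
`σ ≠ 1` of maximal index.
-/

/-! ### Orders of vanishing at a prime -/

section PrimeOrder

variable {B : Type*} [CommRing B]

/-- The order of vanishing `v_P(x)` of an element `x` at an ideal `P`, with values in `ℕ ∪ {∞}`. -/
noncomputable def primeOrder (P : Ideal B) (x : B) : ℕ∞ := emultiplicity P (Ideal.span {x})

variable {P : Ideal B}

theorem primeOrder_zero : primeOrder P (0 : B) = ⊤ := by simp [primeOrder]

theorem primeOrder_neg (x : B) : primeOrder P (-x) = primeOrder P x := by
  simp [primeOrder, Ideal.span_singleton_neg]

theorem primeOrder_sub_comm (x y : B) : primeOrder P (x - y) = primeOrder P (y - x) := by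
  rw [← primeOrder_neg, neg_sub]

/-- Raising to the power `q = |B ⧸ P|` improves congruences. -/
theorem pow_card_sub_pow_card_mem [P.IsPrime] [Finite (B ⧸ P)] {x y : B} {n : ℕ} (hn : n ≠ 0)
    (h : x - y ∈ P ^ n) :
    x ^ Nat.card (B ⧸ P) - y ^ Nat.card (B ⧸ P) ∈ P ^ (n + 1) := by
  set q := Nat.card (B ⧸ P)
  have hxy : Ideal.Quotient.mk P x = Ideal.Quotient.mk P y :=
    Ideal.Quotient.eq.mpr (Ideal.pow_le_self hn h)
  rw [← (Commute.all x y).mul_geom_sum₂, pow_succ]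
  refine Ideal.mul_mem_mul h ?_
  rw [← Ideal.Quotient.eq_zero_iff_mem, map_sum]
  have : ∀ i ∈ Finset.range q, Ideal.Quotient.mk P (x ^ i * y ^ (q - 1 - i)) =
      Ideal.Quotient.mk P y ^ (q - 1) := fun i hi ↦ by
    rw [map_mul, map_pow, map_pow, hxy, ← pow_add]
    congr 1
    have := Finset.mem_range.mp hi
    omega
  rw [Finset.sum_congr rfl this, Finset.sum_const, Finset.card_range, nsmul_eq_mul]
  have : ((q : ℕ) : B ⧸ P) = 0 := by
    cases nonempty_fintype (B ⧸ P)
    rw [show q = Fintype.card (B ⧸ P) from Nat.card_eq_fintype_card]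
    exact Nat.cast_card_eq_zero _
  rw [this, zero_mul]

variable [IsDedekindDomain B]

theorem natCast_le_primeOrder {n : ℕ} {x : B} : (n : ℕ∞) ≤ primeOrder P x ↔ x ∈ P ^ n := by
  rw [primeOrder, ← pow_dvd_iff_le_emultiplicity, Ideal.dvd_span_singleton]

theorem le_primeOrder_iff {m : ℕ∞} {x : B} :
    m ≤ primeOrder P x ↔ ∀ n : ℕ, (n : ℕ∞) ≤ m → x ∈ P ^ n := by
  simp_rw [← natCast_le_primeOrder]
  exact ⟨fun h n hn ↦ hn.trans h, ENat.forall_natCast_le_iff_le.mp⟩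

theorem min_le_primeOrder_add (x y : B) :
    min (primeOrder P x) (primeOrder P y) ≤ primeOrder P (x + y) := by
  rw [le_primeOrder_iff]
  intro n hn
  rw [le_min_iff, natCast_le_primeOrder, natCast_le_primeOrder] at hn
  exact add_mem hn.1 hn.2

/-- Adding an element of high order does not change a smaller order. -/
theorem primeOrder_eq_of_sub_mem {x y : B} {N : ℕ} (h : x - y ∈ P ^ N)
    (hx : primeOrder P x < N) : primeOrder P y = primeOrder P x := by
  rw [← natCast_le_primeOrder] at h
  apply le_antisymm
  · by_contra! hlt
    have := min_le_primeOrder_add (P := P) (x - y) y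
    rw [sub_add_cancel] at this
    exact absurd this (not_le.mpr (lt_min (hx.trans_le h) hlt))
  · have := min_le_primeOrder_add (P := P) (y - x) x
    rw [sub_add_cancel, primeOrder_sub_comm] at this
    exact (le_min (hx.le.trans h) le_rfl).trans this

theorem primeOrder_mul [P.IsPrime] (hP : P ≠ ⊥) (x y : B) :
    primeOrder P (x * y) = primeOrder P x + primeOrder P y := by
  rw [primeOrder, ← Ideal.span_singleton_mul_span_singleton,
    emultiplicity_mul (Ideal.prime_of_isPrime hP inferInstance)]
  rfl

theorem primeOrder_one (hP : P ≠ ⊤) : primeOrder P (1 : B) = 0 := by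
  rw [← Order.lt_one_iff, ← not_le, ← Nat.cast_one, natCast_le_primeOrder, pow_one]
  exact fun h ↦ hP ((Ideal.eq_top_iff_one _).mpr h)

theorem primeOrder_prod [P.IsPrime] (hP : P ≠ ⊥) {ι : Type*} (s : Finset ι) (f : ι → B) :
    primeOrder P (∏ i ∈ s, f i) = ∑ i ∈ s, primeOrder P (f i) := by
  classical
  induction s using Finset.induction_on with
  | empty => simpa using primeOrder_one (Ideal.IsPrime.ne_top ‹_›)
  | insert a s ha ih => rw [Finset.prod_insert ha, Finset.sum_insert ha, primeOrder_mul hP, ih]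

theorem primeOrder_eq_top_iff [P.IsPrime] {x : B} :
    primeOrder P x = ⊤ ↔ x = 0 := by
  refine ⟨fun h ↦ ?_, fun h ↦ h ▸ primeOrder_zero⟩
  have : x ∈ ⨅ n, P ^ n := by
    rw [Submodule.mem_iInf]
    exact fun n ↦ natCast_le_primeOrder.mp (h ▸ le_top)
  rwa [Ideal.iInf_pow_eq_bot_of_isDomain P (Ideal.IsPrime.ne_top ‹_›), Ideal.mem_bot] at this

theorem primeOrder_ne_top [P.IsPrime] {x : B} (hx : x ≠ 0) :
    primeOrder P x ≠ ⊤ := fun h ↦ hx ((primeOrder_eq_top_iff).mp h)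

theorem mem_pow_of_mul_mem_pow [P.IsPrime] (hP : P ≠ ⊥) {x y : B} {m n : ℕ}
    (hx : primeOrder P x ≤ m) (h : x * y ∈ P ^ (n + m)) : y ∈ P ^ n := by
  rw [← natCast_le_primeOrder, primeOrder_mul hP, Nat.cast_add] at h
  rw [← natCast_le_primeOrder]
  have : (n : ℕ∞) + m ≤ primeOrder P y + m := h.trans (by rw [add_comm]; gcongr)
  exact (ENat.add_le_add_iff_right (ENat.natCast_ne_top m)).mp this

/-- Approximate factor theorem: if a polynomial takes values of large order at distinct points,
then its value anywhere is a multiple of the product of the differences, up to an error of large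
order. The loss `c` of precision depends only on the points. -/
theorem exists_eval_sub_mul_prod_mem [P.IsPrime] (hP : P ≠ ⊥) [DecidableEq B] (s : Finset B) :
    ∃ c : ℕ, ∀ (N : ℕ) (g : Polynomial B), (∀ a ∈ s, g.eval a ∈ P ^ (N + c)) →
      ∀ x, ∃ h, g.eval x - h * ∏ a ∈ s, (x - a) ∈ P ^ N := by
  induction s using Finset.induction_on with
  | empty => exact ⟨0, fun N g _ x ↦ ⟨g.eval x, by simp⟩⟩
  | insert a s ha ih =>
    obtain ⟨c, hc⟩ := ih
    have hm (b : B) : ∃ m : ℕ, b ∈ s → primeOrder P (b - a) ≤ m := by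
      by_cases hb : b ∈ s
      · have := primeOrder_ne_top (P := P) (sub_ne_zero.mpr (ne_of_mem_of_not_mem hb ha))
        obtain ⟨m, hm⟩ := ENat.ne_top_iff_exists.mp this
        exact ⟨m, fun _ ↦ hm.ge⟩
      · exact ⟨0, fun h ↦ absurd h hb⟩
    choose m hm using hm
    refine ⟨c + ∑ b ∈ s, m b, fun N g hg x ↦ ?_⟩
    -- Divide by `X - a`; the quotient still has values of large order at the other points.
    obtain ⟨k, hk⟩ := Polynomial.X_sub_C_dvd_sub_C_eval (a := a) (p := g)
    have hev (y : B) : g.eval y = g.eval a + (y - a) * k.eval y := by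
      have := congrArg (Polynomial.eval y) hk
      simp only [Polynomial.eval_sub, Polynomial.eval_C, Polynomial.eval_mul,
        Polynomial.eval_X] at this
      rw [← this]; ring
    have hk' : ∀ b ∈ s, k.eval b ∈ P ^ (N + c) := fun b hb ↦ by
      refine mem_pow_of_mul_mem_pow hP (m := ∑ b ∈ s, m b) ((hm b hb).trans ?_) ?_ (x := b - a)
      · exact_mod_cast Finset.single_le_sum (f := m) (fun _ _ ↦ Nat.zero_le _) hb
      · have := sub_mem (hg b (Finset.mem_insert_of_mem hb)) (hg a (Finset.mem_insert_self a s))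
        rwa [hev b, add_sub_cancel_left, ← add_assoc] at this
    obtain ⟨h, hh⟩ := hc N k hk' x
    refine ⟨h, ?_⟩
    rw [Finset.prod_insert ha, hev x]
    have h1 : g.eval a ∈ P ^ N :=
      Ideal.pow_le_pow_right (by omega) (hg a (Finset.mem_insert_self a s))
    convert add_mem h1 (Ideal.mul_mem_left _ (x - a) hh) using 1
    ring

end PrimeOrder

/-! ### The lower numbering function and Herbrand's inequality -/

section LowerIndex

variable {B G : Type*} [CommRing B] [Group G] [MulSemiringAction G B]

/-- The function `i_P` of a group acting on `B`: the least order at `P` of the elements `σ α - α`.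
The element `σ` acts trivially on `B ⧸ P ^ n` if and only if `n ≤ i_P(σ)`; so the lower ramification
group of index `n ≥ 0` is given by `i_P(σ) ≥ n + 1`, the inertia group by `i_P(σ) ≥ 1`, and
`i_P(1) = ∞`. -/
noncomputable def lowerIndex (P : Ideal B) (σ : G) : ℕ∞ := ⨅ α : B, primeOrder P (σ • α - α)

variable {P : Ideal B}

theorem lowerIndex_le (σ : G) (α : B) : lowerIndex P σ ≤ primeOrder P (σ • α - α) :=
  iInf_le _ α

theorem lowerIndex_one : lowerIndex P (1 : G) = ⊤ := by simp [lowerIndex, primeOrder_zero]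

theorem lowerIndex_inv (σ : G) : lowerIndex P σ⁻¹ = lowerIndex P σ := by
  have key (σ : G) : lowerIndex P σ ≤ lowerIndex P σ⁻¹ := le_iInf fun α ↦ by
    have := lowerIndex_le (P := P) σ (σ⁻¹ • α)
    rwa [smul_inv_smul, primeOrder_sub_comm] at this
  exact le_antisymm (by simpa using key σ⁻¹) (key σ)

theorem smul_mem_pow_of_mem_inertia {σ : G} (hσ : σ ∈ P.inertia G) {n : ℕ} {x : B}
    (hx : x ∈ P ^ n) : σ • x ∈ P ^ n := by
  have h : Ideal.map (MulSemiringAction.toRingHom G B σ) P ≤ P := by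
    rw [Ideal.map_le_iff_le_comap]
    intro x hx
    have := add_mem (hσ x) hx
    rwa [sub_add_cancel] at this
  have := Ideal.mem_map_of_mem (MulSemiringAction.toRingHom G B σ) hx
  rw [Ideal.map_pow] at this
  exact Ideal.pow_right_mono h n this

/-- Every residue class modulo a prime with finite residue ring has a representative which is fixed
by the inertia group modulo a given power of the prime. Such an element is obtained by iterating
the Frobenius map, as for Teichmüller representatives. -/
theorem exists_sub_mem_and_smul_sub_mem [P.IsPrime] [Finite (B ⧸ P)] (N : ℕ) (b : B) :
    ∃ a, a - b ∈ P ∧ ∀ σ ∈ P.inertia G, σ • a - a ∈ P ^ (N + 1) := by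
  induction N with
  | zero => exact ⟨b, by simp, fun σ hσ ↦ by simpa using hσ b⟩
  | succ N ih =>
    obtain ⟨a, hab, ha⟩ := ih
    refine ⟨a ^ Nat.card (B ⧸ P), ?_, fun σ hσ ↦ ?_⟩
    · cases nonempty_fintype (B ⧸ P)
      have : P.IsMaximal := Ideal.Quotient.maximal_of_isField P (Finite.isField_of_domain (B ⧸ P))
      let := Ideal.Quotient.field P
      have h : Ideal.Quotient.mk P a ^ Fintype.card (B ⧸ P) = Ideal.Quotient.mk P a :=
        FiniteField.pow_card _
      rw [Nat.card_eq_fintype_card, ← sub_add_sub_cancel _ a b]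
      refine add_mem (Ideal.Quotient.eq.mp ?_) hab
      rw [map_pow, h]
    · rw [smul_pow']
      exact pow_card_sub_pow_card_mem (Nat.succ_ne_zero N) (ha σ hσ)

variable [IsDedekindDomain B]

theorem natCast_le_lowerIndex {n : ℕ} {σ : G} :
    (n : ℕ∞) ≤ lowerIndex P σ ↔ ∀ α : B, σ • α - α ∈ P ^ n := by
  simp_rw [lowerIndex, le_iInf_iff, natCast_le_primeOrder]

theorem lowerIndex_eq_zero_iff {σ : G} : lowerIndex P σ = 0 ↔ σ ∉ P.inertia G := by
  rw [← Order.lt_one_iff, ← not_le, ← Nat.cast_one, natCast_le_lowerIndex, pow_one]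
  rfl

theorem min_le_lowerIndex_mul (σ τ : G) :
    min (lowerIndex P σ) (lowerIndex P τ) ≤ lowerIndex P (σ * τ) := le_iInf fun α ↦ by
  rw [mul_smul, ← sub_add_sub_cancel _ (τ • α) α]
  exact (min_le_min (lowerIndex_le _ _) (lowerIndex_le _ _)).trans (min_le_primeOrder_add _ _)

theorem lowerIndex_ne_top [P.IsPrime] [FaithfulSMul G B] {σ : G} (hσ : σ ≠ 1) :
    lowerIndex P σ ≠ ⊤ := by
  refine fun h ↦ hσ (FaithfulSMul.eq_of_smul_eq_smul (α := B) fun α ↦ ?_)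
  have := lowerIndex_le (P := P) σ α
  rw [h, top_le_iff, primeOrder_eq_top_iff, sub_eq_zero] at this
  rw [this, one_smul]

/-- Truncated sums of `i_P` over two left cosets of `H`. Only the ultrametric inequality and the
invariance under inversion of `i_P` enter. -/
theorem sum_min_lowerIndex_le [Finite G] (P : Ideal B) (H : Subgroup G) [Fintype H] (σ τ : G) :
    ∑ t : H, min (lowerIndex P (τ * t)) (lowerIndex P σ) ≤
      min (∑ t : H, lowerIndex P (τ * t)) (∑ t : H, lowerIndex P (σ * t)) := by
  refine le_min (Finset.sum_le_sum fun t _ ↦ min_le_left _ _) ?_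
  -- Replace `τ` by a representative of its coset with maximal index.
  obtain ⟨t₀, ht₀⟩ := Finite.exists_max fun t : H ↦ lowerIndex P (τ * t)
  have hsum : ∑ t : H, min (lowerIndex P (τ * t)) (lowerIndex P σ) =
      ∑ t : H, min (lowerIndex P (τ * t₀ * t)) (lowerIndex P σ) := by
    rw [← Equiv.sum_comp (Equiv.mulLeft t₀)]
    simp [mul_assoc]
  rw [hsum]
  refine Finset.sum_le_sum fun t _ ↦ ?_
  have h1 : lowerIndex P (τ * t₀ * t) ≤ lowerIndex P (t : G) := by
    have := min_le_lowerIndex_mul (P := P) (τ * t₀)⁻¹ (τ * t₀ * t)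
    rw [inv_mul_cancel_left, lowerIndex_inv, min_eq_right] at this
    · exact this
    · simpa [mul_assoc] using ht₀ (t₀ * t)
  calc _ ≤ min (lowerIndex P σ) (lowerIndex P (t : G)) := by
        rw [min_comm]; exact min_le_min le_rfl h1
    _ ≤ _ := min_le_lowerIndex_mul _ _

/-- If `π` generates `P` modulo `P ^ 2`, every element is congruent modulo any power of `P` to a
polynomial in `π`, and the polynomial may be chosen to commute with the inertia group up to a given
power of `P`. -/
theorem exists_eval_sub_mem [P.IsPrime] (hP : P ≠ ⊥) [Finite (B ⧸ P)] {π : B} (hπ : π ∈ P)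
    (hπ2 : π ∉ P ^ 2) (N : ℕ) (y : B) (n : ℕ) :
    ∃ g : Polynomial B, g.eval π - y ∈ P ^ n ∧
      ∀ σ ∈ P.inertia G, ∀ z, σ • g.eval z - g.eval (σ • z) ∈ P ^ N := by
  induction n with
  | zero => exact ⟨0, by simp, by simp⟩
  | succ n ih =>
    obtain ⟨g, hg, hg'⟩ := ih
    have hord : π ^ n ∉ P ^ (n + 1) := by
      have h1 : primeOrder P π = 1 := by
        apply le_antisymm
        · rw [← not_lt, ← Order.add_one_le_iff_of_not_isMax (by simp), one_add_one_eq_two,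
            ← Nat.cast_ofNat, natCast_le_primeOrder]
          exact hπ2
        · rw [← Nat.cast_one, natCast_le_primeOrder, pow_one]
          exact hπ
      have := primeOrder_prod hP (Finset.range n) fun _ ↦ π
      simp only [Finset.prod_const, Finset.card_range, h1, Finset.sum_const, nsmul_one] at this
      rw [← natCast_le_primeOrder, this, Nat.cast_le]
      omega
    -- The error term `g(π) - y` is a multiple of `π ^ n` modulo `P ^ (n + 1)`.
    obtain ⟨b, v, hv, huv⟩ :=
      Ideal.exists_mul_add_mem_pow_succ hP _ _ (Ideal.pow_mem_pow hπ n) hord hg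
    obtain ⟨a, hab, ha⟩ := exists_sub_mem_and_smul_sub_mem (G := G) (P := P) N b
    refine ⟨g - Polynomial.C a * Polynomial.X ^ n, ?_, fun σ hσ z ↦ ?_⟩
    · simp only [Polynomial.eval_sub, Polynomial.eval_mul, Polynomial.eval_C, Polynomial.eval_pow,
        Polynomial.eval_X]
      have h1 : (a - b) * π ^ n ∈ P ^ (n + 1) := by
        rw [pow_succ']
        exact Ideal.mul_mem_mul hab (Ideal.pow_mem_pow hπ n)
      convert sub_mem hv h1 using 1
      linear_combination -huv
    · simp only [Polynomial.eval_sub, Polynomial.eval_mul, Polynomial.eval_C, Polynomial.eval_pow,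
        Polynomial.eval_X, smul_sub, smul_mul', smul_pow']
      have h1 : (σ • a - a) * (σ • z) ^ n ∈ P ^ N :=
        Ideal.mul_mem_right _ _ (Ideal.pow_le_pow_right (Nat.le_succ N) (ha σ hσ))
      convert sub_mem (hg' σ hσ z) h1 using 1
      ring

/-- An element of the inertia group moves no element less than it moves a uniformizer. -/
theorem primeOrder_smul_sub_le_lowerIndex [P.IsPrime] (hP : P ≠ ⊥) [Finite (B ⧸ P)] {π : B}
    (hπ : π ∈ P) (hπ2 : π ∉ P ^ 2) {σ : G} (hσ : σ ∈ P.inertia G) :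
    primeOrder P (σ • π - π) ≤ lowerIndex P σ := by
  refine le_iInf fun y ↦ le_primeOrder_iff.mpr fun N hN ↦ ?_
  rw [natCast_le_primeOrder] at hN
  obtain ⟨g, hg, hg'⟩ := exists_eval_sub_mem (G := G) hP hπ hπ2 N y N
  have h1 : g.eval (σ • π) - g.eval π ∈ P ^ N :=
    Ideal.mem_of_dvd _ (g.sub_dvd_eval_sub _ _) hN
  have h2 := smul_mem_pow_of_mem_inertia hσ hg
  rw [smul_sub] at h2
  convert sub_mem (add_mem (add_mem (hg' σ hσ π) h1) hg) h2 using 1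
  ring

theorem lowerIndex_eq_primeOrder_smul_sub [P.IsPrime] (hP : P ≠ ⊥) [Finite (B ⧸ P)] {π : B}
    (hπ : π ∈ P) (hπ2 : π ∉ P ^ 2) {σ : G} (hσ : σ ∈ P.inertia G) :
    lowerIndex P σ = primeOrder P (σ • π - π) :=
  le_antisymm (lowerIndex_le σ π) (primeOrder_smul_sub_le_lowerIndex hP hπ hπ2 hσ)

/-- The case of `sum_lowerIndex_le_primeOrder_smul_sub` where `σ` lies in the inertia group. Elements
of `H` outside the inertia group contribute nothing to the sum. -/
theorem sum_lowerIndex_le_of_mem_inertia [Finite G] [FaithfulSMul G B] [P.IsPrime] (hP : P ≠ ⊥)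
    [Finite (B ⧸ P)] (H : Subgroup G) [Fintype H] {y : B} (hy : ∀ t ∈ H, t • y = y) {σ : G}
    (hσ : σ ∈ P.inertia G) :
    ∑ t : H, lowerIndex P (σ * (t : G)⁻¹) ≤ primeOrder P (σ • y - y) := by
  classical
  obtain ⟨π, hπ, hπ2⟩ := SetLike.exists_of_lt (Ideal.pow_succ_lt_pow hP 1)
  rw [pow_one] at hπ
  have hinj : Set.InjOn (fun t : H ↦ (t : G) • π)
      (Finset.univ.filter fun t : H ↦ (t : G) ∈ P.inertia G) := by
    intro s hs t ht hst
    simp only [Finset.coe_filter, Finset.mem_univ, true_and, Set.mem_ofPred_eq] at hs ht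
    by_contra hne
    have h1 : (t : G)⁻¹ * s ≠ 1 := fun h ↦ hne (Subtype.ext (inv_mul_eq_one.mp h).symm)
    refine lowerIndex_ne_top (P := P) h1 (top_le_iff.mp ?_)
    refine le_trans ?_ (primeOrder_smul_sub_le_lowerIndex hP hπ hπ2 (mul_mem (inv_mem ht) hs))
    rw [mul_smul, show (s : G) • π = (t : G) • π from hst, inv_smul_smul, sub_self,
      primeOrder_zero]
  have hsum : ∑ t : H, lowerIndex P (σ * (t : G)⁻¹) =
      ∑ t ∈ Finset.univ.filter fun t : H ↦ (t : G) ∈ P.inertia G, lowerIndex P (σ * (t : G)⁻¹) := by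
    refine (Finset.sum_filter_of_ne fun t _ ht ↦ ?_).symm
    rw [Ne, lowerIndex_eq_zero_iff, not_not] at ht
    simpa using mul_mem (inv_mem ht) hσ
  set s := (Finset.univ.filter fun t : H ↦ (t : G) ∈ P.inertia G).image fun t : H ↦ (t : G) • π
  obtain ⟨c, hc⟩ := exists_eval_sub_mul_prod_mem hP s
  rw [hsum, le_primeOrder_iff]
  intro N hN
  obtain ⟨g, hg, hg'⟩ := exists_eval_sub_mem (G := G) hP hπ hπ2 (N + c) y (N + c)
  have hval (τ : G) (hτ : τ ∈ P.inertia G) : g.eval (τ • π) - τ • y ∈ P ^ (N + c) := by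
    have := smul_mem_pow_of_mem_inertia hτ hg
    rw [smul_sub] at this
    convert sub_mem this (hg' τ hτ π) using 1
    ring
  -- The polynomial `g - y` almost vanishes at the conjugates `t π`, and its value at `σ π` is
  -- almost `σ y - y`.
  obtain ⟨h, hh⟩ := hc N (g - Polynomial.C y) (by
    intro a ha
    obtain ⟨t, ht, rfl⟩ := Finset.mem_image.mp ha
    have := hval t (by simpa using ht)
    rw [hy _ t.2] at this
    rwa [Polynomial.eval_sub, Polynomial.eval_C]) (σ • π)
  have hprod : ∏ a ∈ s, (σ • π - a) ∈ P ^ N := by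
    rw [Finset.prod_image hinj, ← natCast_le_primeOrder, primeOrder_prod hP]
    refine hN.trans (Finset.sum_le_sum fun t _ ↦ ?_)
    have := lowerIndex_le (P := P) (σ * (t : G)⁻¹) ((t : G) • π)
    rwa [mul_smul, inv_smul_smul] at this
  have h1 := Ideal.pow_le_pow_right (Nat.le_add_right N c) (hval σ hσ)
  rw [Polynomial.eval_sub, Polynomial.eval_C] at hh
  convert sub_mem (add_mem hh (Ideal.mul_mem_left _ h hprod)) h1 using 1
  ring

/-- The inequality behind Herbrand's theorem on the ramification groups of quotients: if `y` is
fixed by a subgroup `H`, then `σ y - y` vanishes at `P` to order at least the sum of `i_P` over the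
coset `σ H`. It rests on Tate's argument with the minimal polynomial of a uniformizer `π` over the
fixed ring of `H`, whose value at `σ π` divides `σ y - y`. -/
theorem sum_lowerIndex_le_primeOrder_smul_sub [Finite G] [FaithfulSMul G B] [P.IsPrime]
    (hP : P ≠ ⊥) [Finite (B ⧸ P)] (H : Subgroup G) [Fintype H] {y : B}
    (hy : ∀ t ∈ H, t • y = y) (σ : G) :
    ∑ t : H, lowerIndex P (σ * (t : G)) ≤ primeOrder P (σ • y - y) := by
  by_cases h : ∃ t : H, σ * (t : G) ∈ P.inertia G
  · obtain ⟨t, ht⟩ := h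
    have := sum_lowerIndex_le_of_mem_inertia hP H hy ht
    rw [mul_smul, hy _ t.2] at this
    rw [← Equiv.sum_comp ((Equiv.inv H).trans (Equiv.mulLeft t))]
    simpa [mul_assoc] using this
  · push Not at h
    simp [fun t ↦ lowerIndex_eq_zero_iff.mpr (h t)]

end LowerIndex

/-! ### An element adapted to all indices -/

section Pointwise

open scoped Pointwise

variable {B G : Type*} [CommRing B] [Group G] [MulSemiringAction G B] {P : Ideal B}
  [IsDedekindDomain B]

/-- There is an element which computes the index `i_P(σ)` of all `σ ∈ G` at once. It is congruent
to the sum of a uniformizer and a lift of a generator of `(B ⧸ P)ˣ` modulo a high power of `P`, and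
to `0` modulo the other conjugates of `P`. -/
theorem exists_primeOrder_smul_sub_le [Finite G] [FaithfulSMul G B] [P.IsPrime] (hP : P ≠ ⊥)
    [Finite (B ⧸ P)] :
    ∃ x : B, ∀ σ : G, primeOrder P (σ • x - x) ≤ lowerIndex P σ := by
  classical
  cases nonempty_fintype G
  have hmax : P.IsMaximal := Ideal.IsPrime.isMaximal inferInstance hP
  obtain ⟨π, hπ, hπ2⟩ := SetLike.exists_of_lt (Ideal.pow_succ_lt_pow hP 1)
  rw [pow_one] at hπ
  have hN : ∃ N : ℕ, ∀ σ : G, σ ≠ 1 → lowerIndex P σ < (N + 1 : ℕ) := by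
    refine ⟨∑ σ : G, (lowerIndex P σ).toNat, fun σ hσ ↦ ?_⟩
    rw [← ENat.natCast_toNat (lowerIndex_ne_top hσ), Nat.cast_lt, Nat.lt_succ_iff]
    exact Finset.single_le_sum (f := fun σ : G ↦ (lowerIndex P σ).toNat)
      (fun _ _ ↦ Nat.zero_le _) (Finset.mem_univ σ)
  obtain ⟨N, hN⟩ := hN
  let := Ideal.Quotient.field P
  obtain ⟨u, hu⟩ := IsCyclic.exists_generator (α := (B ⧸ P)ˣ)
  obtain ⟨b, hb⟩ := Ideal.Quotient.mk_surjective (u : B ⧸ P)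
  obtain ⟨a, hab, ha⟩ := exists_sub_mem_and_smul_sub_mem (G := G) (P := P) N b
  obtain ⟨x, hx⟩ := IsDedekindDomain.exists_forall_sub_mem_ideal
    (s := Finset.univ.image fun σ : G ↦ σ • P) (fun I ↦ I) (fun _ ↦ N + 1)
    (fun I hI ↦ by
      obtain ⟨σ, -, rfl⟩ := Finset.mem_image.mp hI
      refine Ideal.prime_of_isPrime (fun h ↦ hP ?_) inferInstance
      rw [← inv_smul_smul σ P, h]
      exact Ideal.smul_bot _)
    (fun I _ J _ h ↦ h) (fun I ↦ if I.1 = P then a + π else 0)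
  have hxP : x - (a + π) ∈ P ^ (N + 1) := by
    simpa using hx P (Finset.mem_image.mpr ⟨1, Finset.mem_univ _, one_smul _ _⟩)
  have hxσ (σ : G) (h : σ • P ≠ P) : x ∈ σ • P := by
    have := hx (σ • P) (Finset.mem_image.mpr ⟨σ, Finset.mem_univ _, rfl⟩)
    rw [if_neg h, sub_zero] at this
    exact Ideal.pow_le_self (Nat.succ_ne_zero N) this
  have hxu : Ideal.Quotient.mk P x = u := by
    rw [← hb, Ideal.Quotient.eq]
    convert add_mem (add_mem (Ideal.pow_le_self (Nat.succ_ne_zero N) hxP) hπ) hab using 1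
    ring
  have hx0 : x ∉ P := fun h ↦ u.ne_zero (hxu ▸ Ideal.Quotient.eq_zero_iff_mem.mpr h)
  refine ⟨x, fun σ ↦ ?_⟩
  by_cases hσ1 : σ = 1
  · simp [hσ1, lowerIndex_one]
  by_cases hσ : σ ∈ P.inertia G
  · have h1 := lowerIndex_eq_primeOrder_smul_sub hP hπ hπ2 hσ
    rw [h1]
    refine (primeOrder_eq_of_sub_mem (N := N + 1) ?_ (h1 ▸ hN σ hσ1)).le
    have h2 := smul_mem_pow_of_mem_inertia hσ hxP
    rw [smul_sub, smul_add] at h2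
    convert sub_mem (sub_mem hxP h2) (ha σ hσ) using 1
    ring
  · rw [lowerIndex_eq_zero_iff.mpr hσ, le_zero_iff, ← Order.lt_one_iff, ← not_le, ← Nat.cast_one,
      natCast_le_primeOrder, pow_one]
    refine fun h ↦ hσ ?_
    have hstab : σ⁻¹ • P = P := by
      by_contra h1
      refine hx0 ?_
      have h2 := Ideal.mem_inv_pointwise_smul_iff.mp (hxσ _ h1)
      convert sub_mem h2 h using 1
      ring
    have hmem {z : B} (hz : z ∈ P) : σ • z ∈ P := by
      rw [← hstab] at hz
      exact Ideal.mem_inv_pointwise_smul_iff.mp hz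
    -- The class of `x` generates the residue field, so `σ` acts trivially on the residue field.
    intro z
    change σ • z - z ∈ P
    by_cases hz : z ∈ P
    · exact sub_mem (hmem hz) hz
    have hz' : Ideal.Quotient.mk P z ≠ 0 := fun h ↦ hz (Ideal.Quotient.eq_zero_iff_mem.mp h)
    obtain ⟨k, hk⟩ := (mem_powers_iff_mem_zpowers (x := u)).mpr (hu (Units.mk0 _ hz'))
    have hk' : z - x ^ k ∈ P := by
      rw [← Ideal.Quotient.eq, map_pow, hxu, ← Units.val_pow_eq_pow_val]
      exact (congrArg Units.val hk).symm
    have h1 := hmem hk'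
    have h2 : (σ • x) ^ k - x ^ k ∈ P := Ideal.mem_of_dvd _ (sub_dvd_pow_sub_pow _ _ k) h
    rw [smul_sub, smul_pow'] at h1
    convert sub_mem (add_mem h1 h2) hk' using 1
    ring

end Pointwise

/-! ### Tame ramification -/

section Tame

variable {B G : Type*} [CommRing B] [Group G] [MulSemiringAction G B]
  {P : Ideal B}

theorem smul_sub_mem_pow_succ {σ : G} (hσ : ∀ α : B, σ • α - α ∈ P ^ 2) {n : ℕ} {x : B}
    (hx : x ∈ P ^ n) : σ • x - x ∈ P ^ (n + 1) := by
  have hI : σ ∈ P.inertia G := fun α ↦ Ideal.pow_le_self two_ne_zero (hσ α)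
  induction n generalizing x with
  | zero => exact Ideal.pow_le_pow_right (by norm_num) (hσ x)
  | succ n ih =>
    rw [pow_succ] at hx
    refine Submodule.mul_induction_on hx (fun a ha b hb ↦ ?_) fun a b ha hb ↦ ?_
    · have h1 : σ • a * (σ • b - b) ∈ P ^ (n + 1 + 1) := by
        rw [add_assoc, pow_add]
        exact Ideal.mul_mem_mul (smul_mem_pow_of_mem_inertia hI ha) (hσ b)
      have h2 : (σ • a - a) * b ∈ P ^ (n + 1 + 1) := by
        rw [pow_succ]
        exact Ideal.mul_mem_mul (ih ha) hb
      rw [smul_mul']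
      convert add_mem h1 h2 using 1
      ring
    · rw [smul_add]
      convert add_mem ha hb using 1
      ring

/-- The wild ramification group has no nontrivial elements of order prime to the residue
characteristic: if `i_P(σ) = n ≥ 2`, then `σ ^ k α - α ≡ k (σ α - α)` modulo `P ^ (n + 1)`. -/
theorem lowerIndex_le_one_of_isPGroup [IsDedekindDomain B] [FaithfulSMul G B] [P.IsPrime] {p : ℕ}
    (hG : IsPGroup p G) (hp : (p : B) ∉ P) {σ : G} (hσ : σ ≠ 1) : lowerIndex P σ ≤ 1 := by
  by_contra! hlt
  obtain ⟨n, hn⟩ := ENat.ne_top_iff_exists.mp (lowerIndex_ne_top (P := P) hσ)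
  have hn2 : 2 ≤ n := by
    rw [← hn] at hlt
    exact_mod_cast hlt
  have hmem : ∀ α : B, σ • α - α ∈ P ^ n := natCast_le_lowerIndex.mp hn.le
  have hσ2 (α : B) : σ • α - α ∈ P ^ 2 := Ideal.pow_le_pow_right hn2 (hmem α)
  have hI : σ ∈ P.inertia G := fun α ↦ Ideal.pow_le_self two_ne_zero (hσ2 α)
  have hpow (k : ℕ) (α : B) : σ ^ k • α - α - k * (σ • α - α) ∈ P ^ (n + 1) := by
    induction k with
    | zero => simp
    | succ k ih =>
      have h1 := smul_mem_pow_of_mem_inertia hI ih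
      have h2 : (k : B) * (σ • (σ • α - α) - (σ • α - α)) ∈ P ^ (n + 1) :=
        Ideal.mul_mem_left _ _ (smul_sub_mem_pow_succ hσ2 (hmem α))
      have h3 : σ • (k : B) = k := map_natCast (MulSemiringAction.toRingHom G B σ) k
      rw [smul_sub, smul_sub, smul_mul', h3, ← mul_smul, ← pow_succ'] at h1
      convert add_mem h1 h2 using 1
      push_cast
      ring
  obtain ⟨k, hk⟩ := hG σ
  have h1 : ((n + 1 : ℕ) : ℕ∞) ≤ lowerIndex P σ := natCast_le_lowerIndex.mpr fun α ↦ by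
    have h := hpow (p ^ k) α
    rw [hk, one_smul, sub_self, zero_sub, neg_mem_iff, Nat.cast_pow] at h
    refine ((‹P.IsPrime›.mul_mem_pow P h).resolve_left ?_)
    exact fun h ↦ hp (Ideal.IsPrime.mem_of_pow_mem ‹_› _ h)
  rw [← hn, Nat.cast_le] at h1
  omega

end Tame

/-! ### Passage to quotients of the group -/

section Tower

variable {A B G H : Type*} [CommRing A] [IsDedekindDomain A] [CommRing B] [IsDedekindDomain B]
  [Algebra A B] [FaithfulSMul A B] [Group G] [MulSemiringAction G B] [Group H]
  [MulSemiringAction H A] (Q : Ideal A) (P : Ideal B) [Q.IsPrime] [P.IsPrime] [P.LiesOver Q]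

theorem primeOrder_algebraMap (hQ : Q ≠ ⊥) (hP : P ≠ ⊥) (x : A) :
    primeOrder P (algebraMap A B x) = P.ramificationIdx A * primeOrder Q x := by
  rw [← Ideal.ramificationIdx'_eq_ramificationIdx Q P hQ]
  have he := Ideal.IsDedekindDomain.ramificationIdx'_ne_zero_of_liesOver P hQ
  by_cases hx : x = 0
  · simp [hx, primeOrder_zero, he]
  rw [primeOrder, primeOrder, ← Set.image_singleton, ← Ideal.map_span]
  exact Ideal.IsDedekindDomain.emultiplicity_map_eq_ramificationIdx'_mul (by simpa using hx)
    (Ideal.prime_of_isPrime hQ inferInstance).irreducible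
    (Ideal.prime_of_isPrime hP inferInstance).irreducible hP

variable [Finite G] [FaithfulSMul G B] [Finite (B ⧸ P)]

/-- Herbrand's inequality for the image of `σ` in the quotient of `G` acting on `A`. -/
theorem sum_lowerIndex_ker_le (hQ : Q ≠ ⊥) (hP : P ≠ ⊥) (f : G →* H)
    (hf : ∀ (σ : G) (x : A), algebraMap A B (f σ • x) = σ • algebraMap A B x)
    [Fintype f.ker] (σ : G) :
    ∑ t : f.ker, lowerIndex P (σ * t) ≤ P.ramificationIdx A * lowerIndex Q (f σ) := by
  obtain ⟨α, hα : primeOrder Q (f σ • α - α) = lowerIndex Q (f σ)⟩ :=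
    ciInf_mem fun α ↦ primeOrder Q (f σ • α - α)
  rw [← hα, ← primeOrder_algebraMap Q P hQ hP, map_sub, hf]
  refine sum_lowerIndex_le_primeOrder_smul_sub hP _ (fun t ht ↦ ?_) σ
  rw [← hf, MonoidHom.mem_ker.mp ht, one_smul]

/-- If `i_P(σ) = u + 1`, the sum on the left is `|G_0| (φ(u) + 1)` with the Herbrand function `φ` of
`G` at `P`; so after division by `|G_0|` this compares the position of `σ` in the upper numbering
with that of its image. -/
theorem sum_min_lowerIndex_le_tower [Fintype G] [Fintype H] (hQ : Q ≠ ⊥) (hP : P ≠ ⊥) (f : G →* H)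
    (hf : ∀ (σ : G) (x : A), algebraMap A B (f σ • x) = σ • algebraMap A B x) (σ : G) :
    ∑ τ : G, min (lowerIndex P τ) (lowerIndex P σ) ≤
      P.ramificationIdx A * ∑ τ : H, min (lowerIndex Q τ) (lowerIndex Q (f σ)) := by
  classical
  rw [← Finset.sum_fiberwise (s := Finset.univ) (g := f)
    (f := fun τ ↦ min (lowerIndex P τ) (lowerIndex P σ)), Finset.mul_sum]
  refine Finset.sum_le_sum fun ρ _ ↦ ?_
  -- A fibre of `f` is empty or a left coset of the kernel.
  by_cases hρ : ∃ τ, f τ = ρ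
  · obtain ⟨τ, rfl⟩ := hρ
    have hsum : ∑ τ' : G with f τ' = f τ, min (lowerIndex P τ') (lowerIndex P σ) =
        ∑ t : f.ker, min (lowerIndex P (τ * t)) (lowerIndex P σ) := by
      symm
      refine Finset.sum_bij (fun t _ ↦ τ * t) (fun t _ ↦ ?_) (fun s _ t _ h ↦ ?_)
        (fun τ' h ↦ ?_) fun _ _ ↦ rfl
      · simp [MonoidHom.mem_ker.mp t.2]
      · exact Subtype.ext (mul_left_cancel h)
      · refine ⟨⟨τ⁻¹ * τ', ?_⟩, Finset.mem_univ _, mul_inv_cancel_left _ _⟩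
        simp [MonoidHom.mem_ker, (Finset.mem_filter.mp h).2]
    rw [hsum, (mul_right_mono (a := (P.ramificationIdx A : ℕ∞))).map_min]
    exact (sum_min_lowerIndex_le P f.ker σ τ).trans
      (min_le_min (sum_lowerIndex_ker_le Q P hQ hP f hf τ) (sum_lowerIndex_ker_le Q P hQ hP f hf σ))
  · push Not at hρ
    simp [hρ]

end Tower

/-! ### Bounds on the depth of ramification -/

section Depth

variable (K : Type*) {F : Type*} [Field K] [Field F] [Algebra K F]

theorem mem_lowerRamificationGroup_iff [NumberField F] (P : Ideal (𝓞 F)) {x : ℝ} (hx : 0 ≤ x)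
    (σ : Gal(F/K)) :
    σ ∈ lowerRamificationGroup K P x ↔ ((⌈x⌉₊ + 1 : ℕ) : ℕ∞) ≤ lowerIndex P σ := by
  rw [natCast_le_lowerIndex, ← Nat.ceil_add_one hx]
  refine ⟨fun h ↦ h.2, fun h ↦ ⟨fun α ↦ ?_, h⟩⟩
  have h1 : σ • α - α ∈ P :=
    Ideal.pow_le_self (Nat.ceil_pos.mpr (by linarith)).ne' (h α)
  rw [← sub_add_cancel (σ • α) α]
  exact P.add_mem_iff_right h1

theorem ramificationOrder_eq [NumberField F] (P : Ideal (𝓞 F)) (i : ℕ) :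
    ramificationOrder K P i =
      Nat.card {σ : Gal(F/K) // ((i + 1 : ℕ) : ℕ∞) ≤ lowerIndex P σ} := by
  refine Nat.card_congr (Equiv.subtypeEquivRight fun σ ↦ ?_)
  rw [mem_lowerRamificationGroup_iff K P (Nat.cast_nonneg i), Nat.ceil_natCast]

theorem ramificationOrder_pos [FiniteDimensional K F] (P : Ideal (𝓞 F)) (i : ℕ) :
    0 < ramificationOrder K P i := Nat.card_pos

/-- The function `φ` is piecewise linear and unbounded, so it attains every value `y ≥ 0`. -/
theorem exists_herbrandPhi_eq [FiniteDimensional K F] (P : Ideal (𝓞 F)) {y : ℝ} (hy : 0 ≤ y) :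
    ∃ x : ℝ, 0 ≤ x ∧ herbrandPhi K P x = y := by
  set g : ℕ → ℝ := fun i ↦ ramificationOrder K P i
  have hg (i : ℕ) : 1 ≤ g i := Nat.one_le_cast.mpr (ramificationOrder_pos K P i)
  have hg0 : 0 < g 0 := zero_lt_one.trans_le (hg 0)
  have hex : ∃ m : ℕ, y * g 0 < ∑ i ∈ Finset.Icc 1 m, g i := by
    obtain ⟨m, hm⟩ := exists_nat_gt (y * g 0)
    refine ⟨m, hm.trans_le ?_⟩
    have := Finset.card_nsmul_le_sum (Finset.Icc 1 m) g 1 fun i _ ↦ hg i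
    simpa using this
  classical
  obtain ⟨m, hm⟩ : ∃ m, Nat.find hex = m + 1 := by
    refine Nat.exists_eq_succ_of_ne_zero fun h ↦ ?_
    have := Nat.find_spec hex
    rw [h] at this
    simp only [Order.lt_one_iff, Finset.Icc_eq_empty_of_lt, Finset.sum_empty] at this
    exact absurd this (not_lt.mpr (by positivity))
  have h1 : ∑ i ∈ Finset.Icc 1 m, g i ≤ y * g 0 :=
    not_lt.mp (Nat.find_min hex (hm ▸ Nat.lt_succ_self m))
  have h2 : y * g 0 < ∑ i ∈ Finset.Icc 1 m, g i + g (m + 1) := by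
    have := Nat.find_spec hex
    rwa [hm, Finset.sum_Icc_succ_top (Nat.le_add_left 1 m)] at this
  set d := (y * g 0 - ∑ i ∈ Finset.Icc 1 m, g i) / g (m + 1)
  have hgm : 0 < g (m + 1) := zero_lt_one.trans_le (hg _)
  have hd0 : 0 ≤ d := div_nonneg (sub_nonneg.mpr h1) hgm.le
  have hd1 : d < 1 := (div_lt_one hgm).mpr (by linarith)
  have hdg : d * g (m + 1) = y * g 0 - ∑ i ∈ Finset.Icc 1 m, g i := div_mul_cancel₀ _ hgm.ne'
  have hfloor : ⌊(m + d : ℝ)⌋₊ = m := by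
    rw [Nat.floor_eq_iff (by positivity)]
    constructor <;> linarith
  refine ⟨m + d, by positivity, ?_⟩
  rw [herbrandPhi]
  split_ifs with h
  · have hm0 : (m : ℝ) = 0 := le_antisymm (by linarith) (Nat.cast_nonneg m)
    have hd : d = 0 := le_antisymm (by linarith) hd0
    rw [Nat.cast_eq_zero] at hm0
    subst hm0
    rw [hd] at hdg ⊢
    simp only [zero_mul, Order.lt_one_iff, Finset.Icc_eq_empty_of_lt, Finset.sum_empty,
      sub_zero, zero_eq_mul, hg0.ne', or_false] at hdg
    simp [hdg]
  · rw [hfloor, add_sub_cancel_left, div_eq_iff hg0.ne']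
    change _ + d * g (m + 1) = _
    rw [hdg]
    ring

theorem min_natCast_le_sum (a : ℕ∞) (M : ℕ) :
    min a M ≤ ∑ j ∈ Finset.range M, if ((j + 1 : ℕ) : ℕ∞) ≤ a then 1 else 0 := by
  induction M with
  | zero => simp
  | succ M ih =>
    rw [Finset.sum_range_succ]
    split_ifs with h
    · have h1 : min a (M : ℕ∞) = M := min_eq_right ((Nat.cast_le.mpr (Nat.le_succ M)).trans h)
      rw [h1] at ih
      rw [min_eq_right h]
      rw [Nat.cast_add, Nat.cast_one]
      gcongr
    · have h1 : a ≤ M := by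
        rw [not_le, Nat.cast_add, Nat.cast_one] at h
        exact Order.le_of_lt_add_one h
      rw [min_eq_left h1] at ih
      rw [add_zero]
      exact (min_le_left _ _).trans ih

variable [NumberField K] [NumberField F]

/-- A bound `c` on the depth of the ramification of `F/K` at `P`: for `σ ≠ 1` one has
`∑ τ, min (i_P(τ), i_P(σ)) ≤ e c`, where `e` is the ramification index. The left hand side is
`e (φ(u) + 1)` if `i_P(σ) = u + 1`; so for `σ` in the inertia group the condition says that
`σ ∉ D^y` for `y > c - 1`. -/
def RamificationBound (P : Ideal (𝓞 F)) (c : ℝ≥0∞) : Prop :=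
  ∀ σ : Gal(F/K), σ ≠ 1 →
    ((∑ τ : Gal(F/K), min (lowerIndex P τ) (lowerIndex P σ) : ℕ∞) : ℝ≥0∞) ≤
      P.ramificationIdx (𝓞 K) * c

variable {K} [IsGalois K F] {P : Ideal (𝓞 F)}

instance : FaithfulSMul Gal(F/K) (𝓞 F) :=
  (inferInstance : IsGaloisGroup Gal(F/K) (𝓞 K) (𝓞 F)).faithful

theorem card_inertia_eq_ramificationIdx [P.IsPrime] :
    Nat.card (P.inertia Gal(F/K)) = P.ramificationIdx (𝓞 K) := by
  rw [Ideal.card_inertia_eq_ramificationIdxIn (P.under (𝓞 K)) P,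
    Ideal.ramificationIdxIn_eq_ramificationIdx (P.under (𝓞 K)) P Gal(F/K)]

theorem ramificationBound_zero_of_isUnramifiedAt [P.IsPrime]
    [Algebra.IsUnramifiedAt (𝓞 K) P] : RamificationBound K P 0 := by
  intro σ hσ
  have h1 : Nat.card (P.inertia Gal(F/K)) = 1 := by
    rw [card_inertia_eq_ramificationIdx, Ideal.ramificationIdx_eq_one]
  have h2 : lowerIndex P σ = 0 := by
    rw [lowerIndex_eq_zero_iff, Subgroup.card_eq_one.mp h1]
    exact hσ
  simp [h2]

theorem ramificationBound_one_of_isPGroup [P.IsPrime] {p : ℕ} (hG : IsPGroup p Gal(F/K))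
    (hp : (p : 𝓞 F) ∉ P) : RamificationBound K P 1 := by
  classical
  intro σ hσ
  rw [mul_one, ← ENat.toENNReal_coe, ENat.toENNReal_le, ← card_inertia_eq_ramificationIdx (K := K),
    Nat.card_eq_fintype_card, Fintype.card_subtype, Finset.card_eq_sum_ones, Nat.cast_sum,
    Finset.sum_filter]
  refine Finset.sum_le_sum fun τ _ ↦ ?_
  split_ifs with h
  · exact (min_le_right _ _).trans (by simpa using lowerIndex_le_one_of_isPGroup hG hp hσ)
  · simp [lowerIndex_eq_zero_iff.mpr h]

/-- Triviality of `D^y` bounds the depth by `y + 1`: if `x = ψ(y)`, every `σ ≠ 1` has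
`i_P(σ) ≤ ⌊x⌋ + 1`, and `g_0 + ⋯ + g_⌊x⌋ ≤ g_0 (φ(x) + 1)`. -/
theorem ramificationBound_of_upperRamificationGroup_eq_bot [P.IsPrime] {y : ℝ} (hy : 0 ≤ y)
    (h : upperRamificationGroup K P y = ⊥) :
    RamificationBound K P (ENNReal.ofReal (y + 1)) := by
  classical
  intro σ hσ
  obtain ⟨x', hx'0, hx'⟩ := exists_herbrandPhi_eq K P hy
  have hex : ∃ a ∈ Set.Ici (-1 : ℝ), herbrandPhi K P a = y :=
    ⟨x', Set.mem_Ici.mpr (by linarith), hx'⟩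
  -- As `y` is a value of `φ`, the choice in `ψ` is a genuine preimage.
  set x := herbrandPsi K P y
  have hphi : herbrandPhi K P x = y := Function.invFunOn_eq hex
  have hx0 : 0 ≤ x := by
    by_contra! hlt
    rw [herbrandPhi, if_pos hlt.le] at hphi
    linarith
  set m := ⌊x⌋₊
  have hσx : lowerIndex P σ ≤ (m + 1 : ℕ) := by
    have h1 : σ ∉ lowerRamificationGroup K P x := fun h2 ↦ hσ (by
      have h3 : σ ∈ upperRamificationGroup K P y := h2
      rwa [h, Subgroup.mem_bot] at h3)
    rw [mem_lowerRamificationGroup_iff K P hx0, not_le, Nat.cast_add, Nat.cast_one] at h1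
    exact (Order.le_of_lt_add_one h1).trans (Nat.cast_le.mpr (Nat.ceil_le_floor_add_one x))
  have hsum : ∑ τ : Gal(F/K), min (lowerIndex P τ) (lowerIndex P σ) ≤
      ((∑ j ∈ Finset.range (m + 1), ramificationOrder K P j : ℕ) : ℕ∞) := by
    calc _ ≤ ∑ τ : Gal(F/K), ∑ j ∈ Finset.range (m + 1),
          if ((j + 1 : ℕ) : ℕ∞) ≤ lowerIndex P τ then (1 : ℕ∞) else 0 :=
          Finset.sum_le_sum fun τ _ ↦ (min_le_min le_rfl hσx).trans (min_natCast_le_sum _ _)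
      _ = _ := by
          rw [Finset.sum_comm, Nat.cast_sum]
          refine Finset.sum_congr rfl fun j _ ↦ ?_
          rw [ramificationOrder_eq, Nat.card_eq_fintype_card, Fintype.card_subtype,
            ← Finset.sum_filter, Finset.card_eq_sum_ones, Nat.cast_sum, Nat.cast_one]
  have hg0 : (ramificationOrder K P 0 : ℝ) = P.ramificationIdx (𝓞 K) := by
    rw [← card_inertia_eq_ramificationIdx (K := K), ramificationOrder_eq]
    congr 1
    refine Nat.card_congr (Equiv.subtypeEquivRight fun τ ↦ ?_)
    rw [← not_iff_not, ← lowerIndex_eq_zero_iff, ← Order.lt_one_iff, not_le]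
    simp
  have hpos : (0 : ℝ) < ramificationOrder K P 0 :=
    Nat.cast_pos.mpr (ramificationOrder_pos K P 0)
  have hreal : ((∑ j ∈ Finset.range (m + 1), ramificationOrder K P j : ℕ) : ℝ) ≤
      P.ramificationIdx (𝓞 K) * (y + 1) := by
    rw [← hg0, ← hphi, herbrandPhi]
    split_ifs with hx
    · have hxz : x = 0 := le_antisymm hx hx0
      simp [m, hxz]
    · have hsplit : ∑ j ∈ Finset.range (m + 1), (ramificationOrder K P j : ℝ) =
          ∑ j ∈ Finset.Icc 1 m, (ramificationOrder K P j : ℝ) + ramificationOrder K P 0 := by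
        rw [Finset.sum_range_succ', Finset.range_eq_Ico,
          Finset.sum_Ico_add' (fun k ↦ (ramificationOrder K P k : ℝ)) 0 m 1, zero_add,
          Finset.Ico_add_one_right_eq_Icc]
      have hfl : 0 ≤ (x - m) * (ramificationOrder K P (m + 1) : ℝ) :=
        mul_nonneg (sub_nonneg.mpr (Nat.floor_le hx0)) (Nat.cast_nonneg _)
      rw [Nat.cast_sum, hsplit, mul_add, mul_div_cancel₀ _ hpos.ne', mul_one]
      linarith
  calc _ ≤ (((∑ j ∈ Finset.range (m + 1), ramificationOrder K P j : ℕ) : ℕ∞) : ℝ≥0∞) :=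
        ENat.toENNReal_le.mpr hsum
    _ = ENNReal.ofReal ((∑ j ∈ Finset.range (m + 1), ramificationOrder K P j : ℕ) : ℝ) := by
        rw [ENat.toENNReal_coe, ENNReal.ofReal_natCast]
    _ ≤ ENNReal.ofReal (P.ramificationIdx (𝓞 K) * (y + 1)) := ENNReal.ofReal_le_ofReal hreal
    _ = _ := by rw [ENNReal.ofReal_mul (Nat.cast_nonneg _), ENNReal.ofReal_natCast]

/-- Bounds on the depth at the primes of Galois subextensions of `F/K` which detect every
nontrivial automorphism give a bound at `P`. -/
theorem ramificationBound_of_tower [P.IsPrime] (hP : P ≠ ⊥) {c : ℝ≥0∞} {ι : Type*} (E : ι → Type*)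
    [∀ i, Field (E i)] [∀ i, NumberField (E i)] [∀ i, Algebra K (E i)] [∀ i, Algebra (E i) F]
    [∀ i, IsScalarTower K (E i) F] [∀ i, IsGalois K (E i)]
    (hE : ∀ σ : Gal(F/K), σ ≠ 1 → ∃ i, AlgEquiv.restrictNormalHom (E i) σ ≠ 1)
    (hc : ∀ i, RamificationBound K (P.under (𝓞 (E i))) c) : RamificationBound K P c := by
  classical
  intro σ hσ
  obtain ⟨i, hi⟩ := hE σ hσ
  have hfin : Finite (𝓞 F ⧸ P) := Ideal.finiteQuotientOfFreeOfNeBot P hP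
  have hQ : P.under (𝓞 (E i)) ≠ ⊥ := Ideal.IsIntegral.comap_ne_bot _ hP
  have h1 := sum_min_lowerIndex_le_tower (P.under (𝓞 (E i))) P hQ hP
    (AlgEquiv.restrictNormalHom (E i) : Gal(F/K) →* Gal(E i/K)) (fun σ x ↦ by
      apply RingOfIntegers.ext
      exact AlgEquiv.restrictNormal_commutes σ (E i) x) σ
  rw [← ENat.toENNReal_le, ENat.toENNReal_mul, ENat.toENNReal_coe] at h1
  refine h1.trans ?_
  have := Ideal.ramificationIdx_tower (R := 𝓞 K) (P.under (𝓞 (E i))) P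
  rw [this, Nat.cast_mul, mul_comm (Nat.cast (Ideal.ramificationIdx _ (𝓞 K)) : ℝ≥0∞), mul_assoc]
  gcongr
  exact hc i _ hi

end Depth

/-! ### The exponents and the norm of the different -/

section Different

variable {K F : Type*} [Field K] [Field F] [Algebra K F] [NumberField K] [NumberField F]

open Polynomial in
/-- The product of the differences `x - σ x` lies in the different: it is the value at `x` of the
derivative of the characteristic polynomial of `x`. -/
theorem prod_sub_smul_mem_differentIdeal [IsGalois K F] [DecidableEq Gal(F/K)] (x : 𝓞 F)
    (hx : ∀ σ : Gal(F/K), σ ≠ 1 → σ • x ≠ x) :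
    ∏ σ ∈ Finset.univ.erase (1 : Gal(F/K)), (x - σ • x) ∈ differentIdeal (𝓞 K) (𝓞 F) := by
  have htop : IntermediateField.adjoin K {algebraMap (𝓞 F) F x} = ⊤ := by
    rw [← IsGalois.fixedField_fixingSubgroup (IntermediateField.adjoin K {algebraMap (𝓞 F) F x})]
    have : (IntermediateField.adjoin K {algebraMap (𝓞 F) F x}).fixingSubgroup = ⊥ := by
      rw [eq_bot_iff]
      intro σ hσ
      by_contra h1
      refine hx σ h1 (RingOfIntegers.ext ?_)
      exact (IntermediateField.mem_fixingSubgroup_iff _ σ).mp hσ _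
        (IntermediateField.mem_adjoin_simple_self K _)
    rw [this, IntermediateField.fixedField_bot]
  have hadj : Algebra.adjoin K {algebraMap (𝓞 F) F x} = ⊤ := by
    rw [← IntermediateField.adjoin_simple_toSubalgebra_of_isAlgebraic
      (Algebra.IsAlgebraic.isAlgebraic _), htop, IntermediateField.top_toSubalgebra]
  have hmem := aeval_derivative_mem_differentIdeal (𝓞 K) K F x hadj
  obtain ⟨M, hM⟩ := Algebra.IsInvariant.charpoly_mem_lifts (𝓞 K) (𝓞 F) Gal(F/K) x
  have hM' : M.map (algebraMap (𝓞 K) (𝓞 F)) = ∏ σ : Gal(F/K), (X - C (σ • x)) := hM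
  have hprod : ∏ σ : Gal(F/K), (X - C (σ • x)) =
      (X - C x) * ∏ σ ∈ Finset.univ.erase (1 : Gal(F/K)), (X - C (σ • x)) := by
    rw [← Finset.mul_prod_erase _ _ (Finset.mem_univ (1 : Gal(F/K))), one_smul]
  obtain ⟨k, hk⟩ : minpoly (𝓞 K) x ∣ M := by
    refine minpoly.isIntegrallyClosed_dvd (Algebra.IsIntegral.isIntegral x) ?_
    rw [← eval_map_algebraMap, hM', hprod]
    simp
  have h1 : aeval x (derivative M) = ∏ σ ∈ Finset.univ.erase (1 : Gal(F/K)), (x - σ • x) := by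
    rw [← eval_map_algebraMap, ← derivative_map, hM', hprod, derivative_mul]
    simp [eval_prod]
  rw [← h1, hk, derivative_mul, map_add, map_mul, map_mul, minpoly.aeval, zero_mul, add_zero]
  exact Ideal.mul_mem_right _ _ hmem

/-- One half of Hilbert's formula for the exponent of the different. -/
theorem natCast_le_sum_lowerIndex [IsGalois K F] [DecidableEq Gal(F/K)] {P : Ideal (𝓞 F)}
    [P.IsPrime] (hP : P ≠ ⊥) {n : ℕ} (hn : P ^ n ∣ differentIdeal (𝓞 K) (𝓞 F)) :
    (n : ℕ∞) ≤ ∑ σ ∈ Finset.univ.erase (1 : Gal(F/K)), lowerIndex P σ := by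
  have hfin : Finite (𝓞 F ⧸ P) := Ideal.finiteQuotientOfFreeOfNeBot P hP
  obtain ⟨x, hx⟩ := exists_primeOrder_smul_sub_le (G := Gal(F/K)) hP
  have h1 := prod_sub_smul_mem_differentIdeal x fun σ hσ h ↦
    lowerIndex_ne_top (P := P) hσ (top_le_iff.mp (by simpa [h, primeOrder_zero] using hx σ))
  refine (natCast_le_primeOrder.mpr (Ideal.dvd_iff_le.mp hn h1)).trans ?_
  rw [primeOrder_prod hP]
  exact Finset.sum_le_sum fun σ _ ↦ (primeOrder_sub_comm x _).trans_le (hx σ)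

/-- If `σ ≠ 1` has the largest index, the truncated sum for `σ` dominates Hilbert's sum, so a bound
on the depth bounds the exponent of the different. -/
theorem RamificationBound.natCast_le [IsGalois K F] {P : Ideal (𝓞 F)} [P.IsPrime] (hP : P ≠ ⊥)
    {c : ℝ≥0∞} (h : RamificationBound K P c) {n : ℕ}
    (hn : P ^ n ∣ differentIdeal (𝓞 K) (𝓞 F)) :
    (n : ℝ≥0∞) ≤ P.ramificationIdx (𝓞 K) * c := by
  classical
  have hsum := natCast_le_sum_lowerIndex hP hn
  rcases (Finset.univ.erase (1 : Gal(F/K))).eq_empty_or_nonempty with h0 | h0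
  · rw [h0, Finset.sum_empty, nonpos_iff_eq_zero, Nat.cast_eq_zero] at hsum
    simp [hsum]
  obtain ⟨σ, hσ, hmax⟩ := Finset.exists_max_image _ (fun σ ↦ lowerIndex P σ) h0
  refine le_trans ?_ (h σ (Finset.ne_of_mem_erase hσ))
  rw [← ENat.toENNReal_coe, ENat.toENNReal_le]
  calc _ ≤ ∑ τ ∈ Finset.univ.erase (1 : Gal(F/K)), min (lowerIndex P τ) (lowerIndex P σ) := by
        refine hsum.trans (Finset.sum_le_sum fun τ hτ ↦ ?_)
        rw [min_eq_left (hmax τ hτ)]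
    _ ≤ _ := Finset.sum_le_sum_of_subset (Finset.erase_subset _ _)

open UniqueFactorizationMonoid in
/-- A bound for the norm of an ideal from bounds on its exponents, which are given at `P` as a
multiple of the ramification index of `P`. -/
theorem absNorm_le_prod_of_pow_dvd {D : Ideal (𝓞 F)} (hD : D ≠ ⊥)
    (S : Finset (HeightOneSpectrum (𝓞 K))) (c : HeightOneSpectrum (𝓞 K) → ℝ)
    (hc : ∀ 𝔭 ∈ S, 0 ≤ c 𝔭) (hcS : ∀ 𝔭 ∉ S, c 𝔭 = 0)
    (h : ∀ (𝔭 : HeightOneSpectrum (𝓞 K)) (P : Ideal (𝓞 F)) [P.IsPrime], P.LiesOver 𝔭.asIdeal →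
      ∀ n : ℕ, P ^ n ∣ D → (n : ℝ) ≤ P.ramificationIdx (𝓞 K) * c 𝔭) :
    (Ideal.absNorm D : ℝ) ≤
      ∏ 𝔭 ∈ S, (Ideal.absNorm 𝔭.asIdeal : ℝ) ^ (Module.finrank K F * c 𝔭) := by
  classical
  set T := (normalizedFactors D).toFinset
  have hprime {P : Ideal (𝓞 F)} (hP : P ∈ T) : P.IsPrime :=
    Ideal.isPrime_of_prime (prime_of_normalized_factor P (Multiset.mem_toFinset.mp hP))
  have hbot {P : Ideal (𝓞 F)} (hP : P ∈ T) : P ≠ ⊥ :=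
    (prime_of_normalized_factor P (Multiset.mem_toFinset.mp hP)).ne_zero
  have hdvd (P : Ideal (𝓞 F)) : P ^ (normalizedFactors D).count P ∣ D := by
    conv_rhs => rw [← Ideal.prod_normalizedFactors_eq_self hD]
    rw [← Multiset.prod_replicate]
    exact Multiset.prod_dvd_prod_of_le (Multiset.le_count_iff_replicate_le.mp le_rfl)
  have hunder : ∀ P ∈ T, P.under (𝓞 K) ∈ S.image HeightOneSpectrum.asIdeal := fun P hP ↦ by
    have := hprime hP
    let 𝔭 : HeightOneSpectrum (𝓞 K) :=
      ⟨P.under (𝓞 K), inferInstance, Ideal.IsIntegral.comap_ne_bot _ (hbot hP)⟩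
    refine Finset.mem_image.mpr ⟨𝔭, ?_, rfl⟩
    by_contra h𝔭
    have h1 := h 𝔭 P ⟨rfl⟩ 1 (by
      rw [pow_one]; exact dvd_of_mem_normalizedFactors (Multiset.mem_toFinset.mp hP))
    rw [hcS 𝔭 h𝔭, mul_zero, Nat.cast_one] at h1
    linarith
  have hN : (Ideal.absNorm D : ℝ) =
      ∏ P ∈ T, (Ideal.absNorm P : ℝ) ^ (normalizedFactors D).count P := by
    conv_lhs => rw [← Ideal.prod_normalizedFactors_eq_self hD]
    rw [Finset.prod_multiset_count, map_prod, Nat.cast_prod]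
    simp [T]
  rw [hN, ← Finset.prod_fiberwise_of_maps_to hunder, Finset.prod_image fun 𝔭 _ 𝔮 _ h𝔭 ↦
    HeightOneSpectrum.ext h𝔭]
  refine Finset.prod_le_prod (fun 𝔭 _ ↦ Finset.prod_nonneg fun P _ ↦ by positivity) fun 𝔭 h𝔭 ↦ ?_
  have hN1 : (1 : ℝ) ≤ Ideal.absNorm 𝔭.asIdeal := by
    rw [Nat.one_le_cast, Nat.one_le_iff_ne_zero]
    exact fun h0 ↦ 𝔭.ne_bot (Ideal.absNorm_eq_zero_iff.mp h0)
  set T' := T.filter fun P ↦ P.under (𝓞 K) = 𝔭.asIdeal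
  have hT' {P : Ideal (𝓞 F)} (hP : P ∈ T') : P ∈ T ∧ P.IsPrime ∧ P.LiesOver 𝔭.asIdeal :=
    ⟨Finset.mem_of_mem_filter P hP, hprime (Finset.mem_of_mem_filter P hP),
      ⟨(Finset.mem_filter.mp hP).2.symm⟩⟩
  have hsum : ∑ P ∈ T', P.ramificationIdx (𝓞 K) * P.inertiaDeg (𝓞 K) ≤ Module.finrank K F := by
    have hfin : Finite (𝔭.asIdeal.primesOver (𝓞 F)) := inferInstance
    have := Fintype.ofFinite (𝔭.asIdeal.primesOver (𝓞 F))
    rw [IsFractionRing.finrank_eq (𝓞 K) K (𝓞 F) F,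
      ← Ideal.sum_ramification_inertia_eq_finrank 𝔭.asIdeal (𝓞 F), ← Finset.sum_coe_sort T']
    let i : T' → 𝔭.asIdeal.primesOver (𝓞 F) := fun P ↦ ⟨P.1, (hT' P.2).2⟩
    have hi : Function.Injective i := fun P Q hPQ ↦ Subtype.ext (congrArg (·.1) hPQ)
    refine (Finset.sum_map Finset.univ ⟨i, hi⟩ fun Q : 𝔭.asIdeal.primesOver (𝓞 F) ↦
      Q.1.ramificationIdx (𝓞 K) * Q.1.inertiaDeg (𝓞 K)).symm.trans_le ?_
    exact Finset.sum_le_sum_of_subset (Finset.subset_univ _)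
  calc ∏ P ∈ T', (Ideal.absNorm P : ℝ) ^ (normalizedFactors D).count P
      ≤ ∏ P ∈ T', (Ideal.absNorm 𝔭.asIdeal : ℝ) ^
          ((P.ramificationIdx (𝓞 K) * P.inertiaDeg (𝓞 K) : ℕ) * c 𝔭) := by
        refine Finset.prod_le_prod (fun P _ ↦ by positivity) fun P hP ↦ ?_
        obtain ⟨-, hPp, hPo⟩ := hT' hP
        rw [← Ideal.absNorm_pow_inertiaDeg 𝔭.asIdeal P, Nat.cast_pow, ← pow_mul,
          ← Real.rpow_natCast]
        refine Real.rpow_le_rpow_of_exponent_le hN1 ?_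
        have := h 𝔭 P hPo _ (hdvd P)
        push_cast
        calc _ ≤ (P.inertiaDeg (𝓞 K) : ℝ) * (P.ramificationIdx (𝓞 K) * c 𝔭) := by gcongr
          _ = _ := by ring
    _ = (Ideal.absNorm 𝔭.asIdeal : ℝ) ^
          (((∑ P ∈ T', P.ramificationIdx (𝓞 K) * P.inertiaDeg (𝓞 K) : ℕ) : ℝ) * c 𝔭) := by
        rw [← Real.rpow_sum_of_pos (zero_lt_one.trans_le hN1), Nat.cast_sum, Finset.sum_mul]
    _ ≤ _ := by
        refine Real.rpow_le_rpow_of_exponent_le hN1 ?_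
        have := hc 𝔭 h𝔭
        gcongr

end Different

/-! ### Root discriminants in extensions -/

section RootDiscriminant

variable (K L : Type*) [Field K] [Field L] [NumberField K] [NumberField L] [Algebra K L]

theorem rootDiscr_eq_rootDiscr_mul :
    rootDiscr L = rootDiscr K *
      (Ideal.absNorm (differentIdeal (𝓞 K) (𝓞 L)) : ℝ) ^ (Module.finrank ℚ L : ℝ)⁻¹ := by
  have h := natAbs_discr_eq_absNorm_differentIdeal_mul_natAbs_discr_pow K (𝓞 K) L (𝓞 L)
  have hn : (Module.finrank ℚ L : ℝ) = Module.finrank ℚ K * Module.finrank K L := by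
    rw [← Nat.cast_mul, Module.finrank_mul_finrank]
  have hKL : (Module.finrank K L : ℝ) ≠ 0 := Nat.cast_ne_zero.mpr Module.finrank_pos.ne'
  rw [rootDiscr_def, rootDiscr_def, ← Nat.cast_natAbs, ← Nat.cast_natAbs, h, Nat.cast_mul,
    Nat.cast_pow, Real.mul_rpow (by positivity) (by positivity), mul_comm]
  congr 1
  rw [← Real.rpow_natCast, ← Real.rpow_mul (by positivity), hn, mul_inv, mul_left_comm,
    mul_inv_cancel₀ hKL, mul_one]

theorem rootDiscr_le_rootDiscr : rootDiscr K ≤ rootDiscr L := by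
  rw [rootDiscr_eq_rootDiscr_mul K L]
  refine le_mul_of_one_le_right ?_ (Real.one_le_rpow ?_ (by positivity))
  · rw [rootDiscr_def]
    positivity
  · rw [Nat.one_le_cast, Nat.one_le_iff_ne_zero, Ne, Ideal.absNorm_eq_zero_iff]
    exact differentIdeal_ne_bot

end RootDiscriminant

/-! ### Composita of fields -/

section Compositum

variable {K Kbar : Type*} [Field K] [Field Kbar] [Algebra K Kbar]

/-- A finite extension contained in a compositum is contained in a finite subcompositum. -/
theorem exists_finset_le_iSup {𝒮 : Set (IntermediateField K Kbar)} {L : IntermediateField K Kbar}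
    [FiniteDimensional K L] (hL : L ≤ sSup 𝒮) :
    ∃ T : Finset (IntermediateField K Kbar), ↑T ⊆ 𝒮 ∧ L ≤ ⨆ E : T, E.1 := by
  have hFG : L.FG := IntermediateField.essFiniteType_iff.mp inferInstance
  obtain ⟨s, rfl⟩ := hFG
  obtain ⟨T, hT, hle⟩ := (CompleteLattice.isCompactElement_iff_exists_le_sSup_of_le_sSup _ _).mp
    (IntermediateField.adjoin_finset_isCompactElement s) 𝒮 hL
  refine ⟨T, hT, hle.trans_eq ?_⟩
  rw [Finset.sup_eq_iSup, iSup_subtype']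
  rfl

/-- A nontrivial automorphism of a compositum of normal extensions is nontrivial on one of them. -/
theorem exists_restrictNormalHom_ne_one {ι : Type*} (E : ι → IntermediateField K Kbar)
    [∀ i, Normal K (E i)] (F : IntermediateField K Kbar) (hF : F = ⨆ i, E i)
    [∀ i, Algebra (E i) F] [∀ i, IsScalarTower K (E i) F] [∀ i, IsScalarTower (E i) F Kbar]
    {σ : Gal(F/K)} (hσ : σ ≠ 1) : ∃ i, AlgEquiv.restrictNormalHom (E i) σ ≠ 1 := by
  by_contra! h
  refine hσ (AlgEquiv.ext fun x ↦ ?_)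
  have hle : F ≤ IntermediateField.lift
      (IntermediateField.fixedField (Subgroup.zpowers σ) : IntermediateField K F) := by
    conv_lhs => rw [hF]
    refine iSup_le fun i y hy ↦ ?_
    have hyF : y ∈ F := by
      rw [hF]
      exact le_iSup E i hy
    have h1 := AlgEquiv.restrictNormal_commutes σ (E i) ⟨y, hy⟩
    have h2 : algebraMap (E i) F ⟨y, hy⟩ = ⟨y, hyF⟩ := Subtype.ext
      (IsScalarTower.algebraMap_apply (E i) F Kbar ⟨y, hy⟩).symm
    have h3 : σ.restrictNormal (E i) = 1 := h i
    rw [h3, h2, AlgEquiv.one_apply, h2] at h1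
    refine (IntermediateField.mem_lift (⟨y, hyF⟩ : F)).mpr ?_
    rw [IntermediateField.mem_fixedField_iff]
    intro τ hτ
    have : Subgroup.zpowers σ ≤ MulAction.stabilizer Gal(F/K) (⟨y, hyF⟩ : F) := by
      rw [Subgroup.zpowers_le]
      exact h1.symm
    exact this hτ
  have hx := (IntermediateField.mem_lift x).mp (hle x.2)
  exact (IntermediateField.mem_fixedField_iff _ _).mp hx σ (Subgroup.mem_zpowers σ)

theorem exists_finiteDimensional_le_finrank [Algebra.IsAlgebraic K Kbar]
    (M : IntermediateField K Kbar) (hM : ¬ FiniteDimensional K M) (d : ℕ) :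
    ∃ L : IntermediateField K Kbar, L ≤ M ∧ FiniteDimensional K L ∧ d ≤ Module.finrank K L := by
  obtain ⟨L, hL, hd⟩ := IntermediateField.exists_lt_finrank_of_infinite_dimensional hM d
  let e := IntermediateField.liftAlgEquiv L
  exact ⟨IntermediateField.lift L, IntermediateField.lift_le L,
    e.toLinearEquiv.finiteDimensional, hd.le.trans e.toLinearEquiv.finrank_eq.le⟩

end Compositum

/-! ### The tower of `p`-extensions of bounded depth -/

section Tower

variable {K : Type*} [Field K]

open Classical in
/-- The exponent `c` such that the different of a `p`-extension of `K` of depth at most `ν` has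
exponent at most `e c` at the primes over `𝔭`: `0` outside `S`, `1` at the tame primes of `S`, and
`ν 𝔭 + 1` at the wild primes of `S`. -/
noncomputable def differentExponentBound (p : ℕ) (S : Finset (HeightOneSpectrum (𝓞 K)))
    (ν : S → ℝ≥0∞) (𝔭 : HeightOneSpectrum (𝓞 K)) : ℝ :=
  if h : 𝔭 ∈ S then
    if 𝔭 ∈ primesOfResidueChar K p then (ν ⟨𝔭, h⟩).toReal + 1 else 1
  else 0

theorem differentExponentBound_nonneg (p : ℕ) (S : Finset (HeightOneSpectrum (𝓞 K)))
    (ν : S → ℝ≥0∞) (𝔭 : HeightOneSpectrum (𝓞 K)) : 0 ≤ differentExponentBound p S ν 𝔭 := by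
  unfold differentExponentBound
  split_ifs <;> positivity

theorem differentExponentBound_of_notMem (p : ℕ) {S : Finset (HeightOneSpectrum (𝓞 K))}
    (ν : S → ℝ≥0∞) {𝔭 : HeightOneSpectrum (𝓞 K)} (h : 𝔭 ∉ S) :
    differentExponentBound p S ν 𝔭 = 0 := dif_neg h

variable [NumberField K]

/-- The hypotheses on a `p`-extension at the primes outside `S`, at the tame primes of `S` and at
the wild primes of `S` take the common form of a `RamificationBound`. -/
theorem IsBoundedDepthPExtension.ramificationBound {p : ℕ}
    {S : Finset (HeightOneSpectrum (𝓞 K))} {ν : S → ℝ≥0∞} (hν : ∀ 𝔭 : S, ν 𝔭 ≠ ∞) {L : Type*}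
    [Field L] [NumberField L] [Algebra K L] (hL : IsBoundedDepthPExtension K p S ν L)
    {𝔭 : HeightOneSpectrum (𝓞 K)} (P : Ideal (𝓞 L)) [P.IsPrime] [hP : P.LiesOver 𝔭.asIdeal] :
    RamificationBound K P (ENNReal.ofReal (differentExponentBound p S ν 𝔭)) := by
  have := hL.isGalois
  unfold differentExponentBound
  split_ifs with hS hp
  · exact ramificationBound_of_upperRamificationGroup_eq_bot ENNReal.toReal_nonneg
      (hL.depth_le ⟨𝔭, hS⟩ (hν _) P inferInstance hP)
  · rw [ENNReal.ofReal_one]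
    refine ramificationBound_one_of_isPGroup hL.isPGroup fun h ↦ hp ?_
    change (p : 𝓞 K) ∈ 𝔭.asIdeal
    rw [hP.over, Ideal.mem_comap, map_natCast]
    exact h
  · have := hL.unramified_outside 𝔭 hS P hP
    rw [ENNReal.ofReal_zero]
    exact ramificationBound_zero_of_isUnramifiedAt

theorem rootDiscr_le_of_ramificationBound (F : Type*) [Field F] [NumberField F] [Algebra K F]
    [IsGalois K F] (S : Finset (HeightOneSpectrum (𝓞 K))) (c : HeightOneSpectrum (𝓞 K) → ℝ)
    (hc : ∀ 𝔭, 0 ≤ c 𝔭) (hcS : ∀ 𝔭 ∉ S, c 𝔭 = 0)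
    (h : ∀ (𝔭 : HeightOneSpectrum (𝓞 K)) (P : Ideal (𝓞 F)) [P.IsPrime] [P.LiesOver 𝔭.asIdeal],
      RamificationBound K P (ENNReal.ofReal (c 𝔭))) :
    rootDiscr F ≤ rootDiscr K *
      ∏ 𝔭 ∈ S, (Ideal.absNorm 𝔭.asIdeal : ℝ) ^ (c 𝔭 / (Module.finrank ℚ K : ℝ)) := by
  have hn : (Module.finrank ℚ F : ℝ) = Module.finrank ℚ K * Module.finrank K F := by
    rw [← Nat.cast_mul, Module.finrank_mul_finrank]
  have hKF : (Module.finrank K F : ℝ) ≠ 0 := Nat.cast_ne_zero.mpr Module.finrank_pos.ne'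
  have hK : 0 ≤ rootDiscr K := by
    rw [rootDiscr_def]
    positivity
  rw [rootDiscr_eq_rootDiscr_mul K F]
  refine mul_le_mul_of_nonneg_left ?_ hK
  have hnorm := absNorm_le_prod_of_pow_dvd (D := differentIdeal (𝓞 K) (𝓞 F))
    differentIdeal_ne_bot S c (fun 𝔭 _ ↦ hc 𝔭) hcS fun 𝔭 P _ _ n hn ↦ by
      have hP : P ≠ ⊥ := Ideal.ne_bot_of_liesOver_of_ne_bot 𝔭.ne_bot P
      have := (h 𝔭 P).natCast_le hP hn
      rw [← ENNReal.ofReal_natCast, ← ENNReal.ofReal_natCast,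
        ← ENNReal.ofReal_mul (Nat.cast_nonneg _)] at this
      exact (ENNReal.ofReal_le_ofReal_iff (mul_nonneg (Nat.cast_nonneg _) (hc 𝔭))).mp this
  refine (Real.rpow_le_rpow (by positivity) hnorm (by positivity)).trans_eq ?_
  rw [← Real.finsetProd_rpow _ _ fun 𝔭 _ ↦ by positivity]
  refine Finset.prod_congr rfl fun 𝔭 _ ↦ ?_
  rw [← Real.rpow_mul (by positivity), hn]
  congr 1
  field_simp

variable {Kbar : Type*} [Field Kbar] [Algebra K Kbar]

theorem rootDiscr_le_of_le_boundedDepthTower {p : ℕ} {S : Finset (HeightOneSpectrum (𝓞 K))}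
    {ν : S → ℝ≥0∞} (hν : ∀ 𝔭 : S, ν 𝔭 ≠ ∞) (L : IntermediateField K Kbar)
    [FiniteDimensional K L] (hL : L ≤ boundedDepthTower K Kbar p S ν) :
    rootDiscr L ≤ rootDiscr K * ∏ 𝔭 ∈ S, (Ideal.absNorm 𝔭.asIdeal : ℝ) ^
      (differentExponentBound p S ν 𝔭 / (Module.finrank ℚ K : ℝ)) := by
  obtain ⟨T, hT, hLT⟩ := exists_finset_le_iSup hL
  have hE (E : T) : IsBoundedDepthPExtension K p S ν E.1 := hT E.2
  have hfin (E : T) : FiniteDimensional K E.1 := (hE E).finiteDimensional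
  have hgal (E : T) : IsGalois K E.1 := (hE E).isGalois
  obtain ⟨F, hF⟩ : ∃ F, F = ⨆ E : T, E.1 := ⟨_, rfl⟩
  have hFfin : FiniteDimensional K F := by rw [hF]; infer_instance
  have hFgal : IsGalois K F := by
    rw [hF]
    exact { }
  rw [← hF] at hLT
  let _ (E : T) : Algebra E.1 F :=
    (IntermediateField.inclusion (hF ▸ le_iSup (fun E : T ↦ E.1) E)).toAlgebra
  have (E : T) : IsScalarTower K E.1 F := .of_algebraMap_eq' rfl
  have (E : T) : IsScalarTower E.1 F Kbar := .of_algebraMap_eq' rfl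
  let _ : Algebra L F := (IntermediateField.inclusion hLT).toAlgebra
  refine (rootDiscr_le_rootDiscr L F).trans ?_
  refine rootDiscr_le_of_ramificationBound F S _ (differentExponentBound_nonneg p S ν)
    (fun 𝔭 ↦ differentExponentBound_of_notMem p ν) fun 𝔭 P _ _ ↦ ?_
  refine ramificationBound_of_tower (Ideal.ne_bot_of_liesOver_of_ne_bot 𝔭.ne_bot P)
    (fun E : T ↦ E.1) (fun σ hσ ↦ exists_restrictNormalHom_ne_one _ F hF hσ) fun E ↦ ?_
  have : (P.under (𝓞 E.1)).LiesOver 𝔭.asIdeal := .tower_bot P (P.under (𝓞 E.1)) 𝔭.asIdeal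
  exact (hE E).ramificationBound hν _

end Tower

open Classical in
theorem theorem4p2 {K : Type*} [Field K] [NumberField K] {Kbar : Type*} [Field Kbar]
    [Algebra K Kbar] [IsAlgClosure K Kbar] (p : ℕ) (hp : p.Prime)
    (S : Finset (HeightOneSpectrum (𝓞 K))) (ν : S → ℝ≥0∞) (hν : ∀ 𝔭 : S, ν 𝔭 ≠ ∞) :
    (∃ C : ℝ, ∀ (L : IntermediateField K Kbar) [FiniteDimensional K L],
      L ≤ boundedDepthTower K Kbar p S ν → rootDiscr L ≤ C) ∧
    (∀ (L : IntermediateField K Kbar) [FiniteDimensional K L],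
      L ≤ boundedDepthTower K Kbar p S ν →
        rootDiscr L ≤ rootDiscr K *
          (∏ 𝔭 : S with 𝔭.1 ∉ primesOfResidueChar K p,
            (Ideal.absNorm 𝔭.1.asIdeal : ℝ) ^ (1 / (Module.finrank ℚ K : ℝ))) *
          (∏ 𝔭 : S with 𝔭.1 ∈ primesOfResidueChar K p,
            (Ideal.absNorm 𝔭.1.asIdeal : ℝ) ^
              (((ν 𝔭).toReal + 1) / (Module.finrank ℚ K : ℝ)))) ∧
    (¬ FiniteDimensional K (boundedDepthTower K Kbar p S ν) →
      IsAsymptoticallyGood (boundedDepthTower K Kbar p S ν)) := by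
  have hbound (L : IntermediateField K Kbar) [FiniteDimensional K L]
      (hL : L ≤ boundedDepthTower K Kbar p S ν) := rootDiscr_le_of_le_boundedDepthTower hν L hL
  have : Algebra.IsAlgebraic K Kbar := IsAlgClosure.isAlgebraic
  refine ⟨⟨_, hbound⟩, fun L _ hL ↦ (hbound L hL).trans_eq ?_, fun hM ↦
    ⟨exists_finiteDimensional_le_finrank _ hM, _, hbound⟩⟩
  -- Split the product over `S` into the tame and the wild primes.
  rw [mul_assoc]
  congr 1
  rw [← Finset.prod_coe_sort S, ← Finset.prod_filter_not_mul_prod_filter Finset.univ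
    fun 𝔭 : S ↦ 𝔭.1 ∈ primesOfResidueChar K p]
  congr 1 <;> refine Finset.prod_congr rfl fun 𝔭 h𝔭 ↦ ?_ <;>
    simp [differentExponentBound, (Finset.mem_filter.mp h𝔭).2]
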